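/- **Theorem 3.7 (Differential Representer Theorem on Poisson manifolds).** Let $P$ be a smooth $d$-dimensional manifold (Hausdorff, second countable) with a Poisson bracket $\{\cdot,\cdot\}$ on $C^\infty(P)$, and let $g$ be a smooth Riemannian metric on $P$. Let $B(z)(\mathbf dF(z),\mathbf dG(z))=\{F,G\}(z)$ be the Poisson tensor, let $B^\sharp:T^*P\to TP$ be given by $\alpha\cdot B^\sharp(z)\beta=B(z)(\alpha,\beta)$, let $X_h=B^\sharp(\mathbf dh)$ be the Hamiltonian vector field of a differentiable function $h$, and let $J(z)v=B^\sharp(z)(g^\flat(z)v)$ be the compatible structure. Assume that $J$ is bounded: there are a constant $C>0$ and a function $\gamma:P\to(0,C^2]$ with $g(z)(J(z)v,J(z)v)\le\gamma(z)\,g(z)(v,v)$ for all $z\in P$, $v\in T_zP$. Let $K:P\times P\to\mathbb R$ be a Mercer kernel (symmetric and positive semidefinite) in $C_b^3(P\times P)$; that is, $K$ is of class $C^3$ and bounded, and for $k=1,2,3$ $$\sup_{y\in T^{k-1}(P\times P)}\ \sup_{0\ne v\in T_y(T^{k-1}(P\times P))}\frac{|D^kK(y)\cdot v|}{\|v\|_{g_{k-1}}}<\infty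 ,$$ where $D^kK:T^k(P\times P)\to\mathbb R$ is the differential of $D^{k-1}K:T^{k-1}(P\times P)\to\mathbb R$, $D^0K=K$, and $g_0,g_1,g_2$ are given Riemannian metrics on $P\times P$, $T(P\times P)$ and $T^2(P\times P)$. Let $\mathcal H_K$ be the reproducing kernel Hilbert space of $K$, and write $K_y=K(y,\cdot)$. Let $N\ge1$, let $\mathbf z_N=(z_1,\dots,z_N)\in P^N$ be arbitrary points, and let $\mathbf x=(x_1,\dots,x_N)\in T_{\mathbf z_N}P:=\prod_{n}T_{z_n}P$ be arbitrary tangent vectors (for instance, realizations of noisy samples $x_n=X_H(z_n)+\varepsilon_n$ of a Hamiltonian vector field). For $u,v\in T_{\mathbf z_N}P$ put $g_N(u,v)=\sum_{n}g(z_n)(u_n,v_n)$. For a differentiable $h$ put $X_h(\mathbf z_N)=(X_h(z_1),\dots,X_h(z_N))$. For $\mathbf c\in T_{\mathbf z_N}P$, let $g_N(\mathbf c,X_{K_\cdot}(\mathbf z_N))$ be the function $y\mapsto g_N(\mathbf c,X_{K_y}(\mathbf z_N))$ on $P$, and put $G_N\mathbf c=X_{g_N(\mathbf c,X_{K_\cdot}(\mathbf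 z_N))}(\mathbf z_N)\in T_{\mathbf z_N}P$ (the generalized differential Gram matrix). Then every function in $\mathcal H_K$ is differentiable, and for every $\lambda>0$ the map $G_N+\lambda N I:T_{\mathbf z_N}P\to T_{\mathbf z_N}P$ is linear and invertible, and the regularized empirical risk $$\widehat R_{\lambda,N}(h)=\frac1N\sum_{n=1}^N\|X_h(z_n)-x_n\|_g^2+\lambda\|h\|_{\mathcal H_K}^2,\qquad h\in\mathcal H_K,$$ has exactly one minimizer $\widehat h_{\lambda,N}$ over $\mathcal H_K$, namely $$\widehat h_{\lambda,N}=g_N(\widehat{\mathbf c},X_{K_\cdot}(\mathbf z_N)),\qquad \widehat{\mathbf c}=(G_N+\lambda N I)^{-1}\mathbf x .$$ -/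

import Mathlib

open scoped Manifold ContDiff

noncomputable section

/-- A smooth Riemannian metric on a manifold `M`. -/
abbrev RiemMetric {E H : Type*} [NormedAddCommGroup E] [NormedSpace ℝ E] [TopologicalSpace H]
    (I : ModelWithCorners ℝ E H) (M : Type*) [TopologicalSpace M] [ChartedSpace H M]
    [IsManifold I ∞ M] : Type _ :=
  Bundle.ContMDiffRiemannianMetric I ∞ E (fun x : M => TangentSpace I x)

/-- The differential of a real function, regarded as a function on the tangent bundle:
`(x, v) ↦ Df(x) · v`. Iterating it gives the higher-order differentials `D^k f : T^k M → ℝ`. -/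
def bundleDifferential {E H : Type*} [NormedAddCommGroup E] [NormedSpace ℝ E]
    [TopologicalSpace H] (I : ModelWithCorners ℝ E H) {M : Type*} [TopologicalSpace M]
    [ChartedSpace H M] (f : M → ℝ) : TangentBundle I M → ℝ :=
  fun p => mvfderiv I f p.proj p.snd

/-- `f` has bounded differential with respect to the metric `g`, that is,
`sup_x sup_{v ≠ 0} |Df(x) · v| / ‖v‖_g < ∞`. -/
def HasBoundedDifferential {E H : Type*} [NormedAddCommGroup E] [NormedSpace ℝ E]
    [TopologicalSpace H] {I : ModelWithCorners ℝ E H} {M : Type*} [TopologicalSpace M]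
    [ChartedSpace H M] [IsManifold I ∞ M] (g : RiemMetric I M) (f : M → ℝ) : Prop :=
  ∃ C : ℝ, ∀ (x : M) (v : TangentSpace I x), |mvfderiv I f x v| ≤ C * √(g.inner x v v)

/-- The space `C_b^3(M)` of functions of class `C^3` such that `f`, `Df`, `D²f` and `D³f` are
bounded. The norm of `D^{k+1} f` is the one of the differential of `D^k f : T^k M → ℝ`, measured
with a given Riemannian metric `g_k` on `T^k M`. -/
structure MemCb3 {E H : Type*} [NormedAddCommGroup E] [NormedSpace ℝ E]
    [TopologicalSpace H] {I : ModelWithCorners ℝ E H} {M : Type*} [TopologicalSpace M]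
    [ChartedSpace H M] [IsManifold I ∞ M] (g₀ : RiemMetric I M)
    (g₁ : RiemMetric I.tangent (TangentBundle I M))
    (g₂ : RiemMetric I.tangent.tangent (TangentBundle I.tangent (TangentBundle I M)))
    (f : M → ℝ) : Prop where
  contMDiff : ContMDiff I 𝓘(ℝ, ℝ) 3 f
  bounded : ∃ C : ℝ, ∀ x, |f x| ≤ C
  bounded_one : HasBoundedDifferential g₀ f
  bounded_two : HasBoundedDifferential g₁ (bundleDifferential I f)
  bounded_three : HasBoundedDifferential g₂ (bundleDifferential I.tangent (bundleDifferential I f))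

/-- A Mercer kernel: a symmetric and positive semidefinite function. -/
structure IsMercerKernel {X : Type*} (K : X → X → ℝ) : Prop where
  symm : ∀ x y, K x y = K y x
  posSemidef : ∀ (n : ℕ) (x : Fin n → X) (c : Fin n → ℝ),
    0 ≤ ∑ i, ∑ j, c i * c j * K (x i) (x j)

/-- The Hilbert space of functions `ℋ` is the reproducing kernel Hilbert space of the kernel `K`:
every `K(x, ·)` belongs to `ℋ`, and `f x = ⟪f, K(x, ·)⟫` for all `f ∈ ℋ`. -/
def IsRKHSOf {X : Type*} (ℋ : Type*) [NormedAddCommGroup ℋ] [InnerProductSpace ℝ ℋ]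
    [RKHS ℝ ℋ X ℝ] (K : X → X → ℝ) : Prop :=
  ∀ x : X, ∃ k : ℋ, (∀ y, k y = K x y) ∧ ∀ f : ℋ, f x = inner ℝ f k

section Poisson

variable {d : ℕ} {P : Type*} [TopologicalSpace P] [ChartedSpace (EuclideanSpace ℝ (Fin d)) P]

variable (d P) in
/-- A Poisson bracket on `C^∞(P)`: a Lie bracket that is a derivation in each factor. -/
structure PoissonBracket where
  bracket : C^∞⟮𝓡 d, P; ℝ⟯ →ₗ[ℝ] C^∞⟮𝓡 d, P; ℝ⟯ →ₗ[ℝ] C^∞⟮𝓡 d, P; ℝ⟯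
  alternating : ∀ F, bracket F F = 0
  jacobi : ∀ F G H, bracket F (bracket G H) + bracket G (bracket H F) + bracket H (bracket F G) = 0
  leibniz_left : ∀ F G H, bracket (F * G) H = bracket F H * G + F * bracket G H
  leibniz_right : ∀ F G H, bracket F (G * H) = bracket F G * H + G * bracket F H

variable [T2Space P] [IsManifold (𝓡 d) ∞ P]

/-- A smooth function whose differential at `z` is the covector `α`
(see `mvfderiv_covectorExtension`): `α` read in the chart at `z`, times a bump function. -/
def covectorExtension (z : P) :
    Module.Dual ℝ (TangentSpace (𝓡 d) z) →ₗ[ℝ] C^∞⟮𝓡 d, P; ℝ⟯ where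
  toFun α :=
    ⟨fun y => (Classical.arbitrary (SmoothBumpFunction (𝓡 d) z)) y •
      LinearMap.toContinuousLinearMap (𝕜 := ℝ) (E := EuclideanSpace ℝ (Fin d)) α
        (extChartAt (𝓡 d) z y),
      SmoothBumpFunction.contMDiff_smul _ <|
        (ContinuousLinearMap.contMDiff _).comp_contMDiffOn contMDiffOn_extChartAt⟩
  map_add' α β := by ext y; exact mul_add _ _ _
  map_smul' c α := by ext y; exact mul_left_comm _ _ _

theorem mvfderiv_covectorExtension (z : P) (α : Module.Dual ℝ (TangentSpace (𝓡 d) z)) :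
    (mvfderiv (𝓡 d) (covectorExtension z α) z : TangentSpace (𝓡 d) z →ₗ[ℝ] ℝ) = α := by
  have h : (covectorExtension z α : P → ℝ) =ᶠ[nhds z]
      (LinearMap.toContinuousLinearMap (𝕜 := ℝ) (E := EuclideanSpace ℝ (Fin d)) α) ∘
        extChartAt (𝓡 d) z := by
    filter_upwards [(Classical.arbitrary (SmoothBumpFunction (𝓡 d) z)).eventuallyEq_one] with y hy
    change Classical.arbitrary (SmoothBumpFunction (𝓡 d) z) y • (_ : ℝ) = _
    rw [hy]
    exact one_smul _ _
  have h2 : HasMFDerivAt (𝓡 d) 𝓘(ℝ, ℝ) (covectorExtension z α : P → ℝ) z _ :=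
    (((LinearMap.toContinuousLinearMap (𝕜 := ℝ) (E := EuclideanSpace ℝ (Fin d))
      α).hasMFDerivAt).comp z
      (mdifferentiableAt_extChartAt (mem_chart_source _ z)).hasMFDerivAt).congr_of_eventuallyEq h
  ext v
  simp only [mvfderiv, h2.mfderiv]
  rw [mfderiv_extChartAt_self]
  rfl

/-- The Poisson tensor: `B(z)(α, β) = {F, G}(z)` for smooth functions `F`, `G` with
`dF(z) = α` and `dG(z) = β` (the value depends only on these differentials, since the bracket is a
derivation in each factor; it is linear in `α` and in `β`). -/
def PoissonBracket.tensor (pb : PoissonBracket d P) (z : P)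
    (α β : Module.Dual ℝ (TangentSpace (𝓡 d) z)) : ℝ :=
  pb.bracket (covectorExtension z α) (covectorExtension z β) z

instance (z : P) : FiniteDimensional ℝ (TangentSpace (𝓡 d) z) :=
  inferInstanceAs (FiniteDimensional ℝ (EuclideanSpace ℝ (Fin d)))

/-- The bundle map `B^♯ : T^*P → TP`, determined by `α (B^♯(z) β) = B(z)(α, β)`
(see `PoissonBracket.apply_sharp`). -/
def PoissonBracket.sharp (pb : PoissonBracket d P) (z : P)
    (β : Module.Dual ℝ (TangentSpace (𝓡 d) z)) : TangentSpace (𝓡 d) z :=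
  (Module.evalEquiv ℝ (TangentSpace (𝓡 d) z)).symm
    { toFun := fun α => pb.tensor z α β
      map_add' := fun α α' => by simp [PoissonBracket.tensor]
      map_smul' := fun c α => by simp [PoissonBracket.tensor] }

theorem PoissonBracket.apply_sharp (pb : PoissonBracket d P) (z : P)
    (α β : Module.Dual ℝ (TangentSpace (𝓡 d) z)) : α (pb.sharp z β) = pb.tensor z α β := by
  unfold PoissonBracket.sharp
  rw [Module.apply_evalEquiv_symm_apply]
  rfl

/-- The Hamiltonian vector field `X_h = B^♯(dh)` of a differentiable function `h`. -/
def PoissonBracket.hamVF (pb : PoissonBracket d P) (h : P → ℝ) (z : P) : TangentSpace (𝓡 d) z :=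
  pb.sharp z (mvfderiv (𝓡 d) h z : TangentSpace (𝓡 d) z →ₗ[ℝ] ℝ)

/-- The compatible structure `J(z) v = B^♯(z)(g^♭(z) v)`. -/
def PoissonBracket.compat (pb : PoissonBracket d P) (g : RiemMetric (𝓡 d) P) (z : P)
    (v : TangentSpace (𝓡 d) z) : TangentSpace (𝓡 d) z :=
  pb.sharp z (g.inner z v : TangentSpace (𝓡 d) z →ₗ[ℝ] ℝ)

/-- Boundedness of the compatible structure: `g(Jv, Jv) ≤ γ g(v, v)` for some positive function
`γ` that is bounded above by a constant `C²`. -/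
def PoissonBracket.IsBoundedCompat (pb : PoissonBracket d P) (g : RiemMetric (𝓡 d) P) : Prop :=
  ∃ (γ : P → ℝ) (C : ℝ), 0 < C ∧ (∀ z, 0 < γ z ∧ γ z ≤ C ^ 2) ∧
    ∀ (z : P) (v : TangentSpace (𝓡 d) z),
      g.inner z (pb.compat g z v) (pb.compat g z v) ≤ γ z * g.inner z v v

variable (d) in
/-- The product `T_{z_1}P × ⋯ × T_{z_N}P` of tangent spaces. -/
abbrev TangentProd {N : ℕ} (z : Fin N → P) : Type := ∀ n, TangentSpace (𝓡 d) (z n)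

/-- The inner product `g_N(u, v) = ∑ g(z_n)(u_n, v_n)`. -/
def innerN (g : RiemMetric (𝓡 d) P) {N : ℕ} (z : Fin N → P) (u v : TangentProd d z) : ℝ :=
  ∑ n, g.inner (z n) (u n) (v n)

/-- The function `g_N(c, X_{K_·}(z_N)) : y ↦ g_N(c, X_{K_y}(z_N))` on `P`, where
`K_y = K(y, ·)` is the kernel section at `y`. -/
def kernelExpansion (pb : PoissonBracket d P) (g : RiemMetric (𝓡 d) P) (K : P → P → ℝ)
    {N : ℕ} (z : Fin N → P) (c : TangentProd d z) : P → ℝ :=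
  fun y => innerN g z c (fun n => pb.hamVF (K y) (z n))

/-- The generalized differential Gram matrix
`G_N c = X_{g_N(c, X_{K_·}(z_N))}(z_N)`, a map from `T_{z_N}P` to itself. -/
def gramMap (pb : PoissonBracket d P) (g : RiemMetric (𝓡 d) P) (K : P → P → ℝ)
    {N : ℕ} (z : Fin N → P) (c : TangentProd d z) : TangentProd d z :=
  fun n => pb.hamVF (kernelExpansion pb g K z c) (z n)

/-- The regularized empirical risk
`R(h) = (1/N) ∑ ‖X_h(z_n) - x_n‖_g² + λ ‖h‖²` on the RKHS `ℋ`. -/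
def empRisk (pb : PoissonBracket d P) (g : RiemMetric (𝓡 d) P) (ℋ : Type*)
    [NormedAddCommGroup ℋ] [InnerProductSpace ℝ ℋ] [RKHS ℝ ℋ P ℝ]
    {N : ℕ} (z : Fin N → P) (x : TangentProd d z) (lam : ℝ) (h : ℋ) : ℝ :=
  (1 / (N : ℝ)) * ∑ n, g.inner (z n) (pb.hamVF h (z n) - x n) (pb.hamVF h (z n) - x n)
    + lam * ‖h‖ ^ 2

end Poisson

end

/-! Put `Φ y = K_y`, so that `K x y = ⟪Φ x, Φ y⟫` and `h y = ⟪h, Φ y⟫`. Inner products of difference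
quotients of `Φ` are second differences of `K`; since `K` is `C^2` they converge to a mixed second
derivative, so the quotients are Cauchy and `Φ` is differentiable into `ℋ`
(`differentiableAt_of_contDiffAt_inner`). Hence `dh(z) v = ⟪h, dΦ(z) v⟫`, and sampling `L h =
X_h(z_N)` is a linear map from `ℋ` to a finite-dimensional space.

Skew-symmetry of the Poisson tensor gives the adjoint `L* c = -∑ dΦ(z_n) (J c_n)`. The kernel
expansion is `L* c` and the Gram map is `L L*`. What remains is ridge regression: `L L* + λN` is
positive definite, and completing the square at `L* ĉ` gives existence and uniqueness at once
(`regularizedRisk_eq`). -/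

noncomputable section

/-! ### Differentiability of the feature map -/

open Filter Topology in
/-- A map `Φ` into a Hilbert space is differentiable at `a` as soon as the inner products of its
increments at `a` agree with a bilinear form up to `o(‖u‖ * ‖w‖)`. -/
theorem differentiableAt_of_inner_sub_approx {E H : Type*} [NormedAddCommGroup E]
    [NormedSpace ℝ E] [NormedAddCommGroup H] [InnerProductSpace ℝ H] [CompleteSpace H]
    {Φ : E → H} {a : E} (M : E →L[ℝ] E →L[ℝ] ℝ)
    (hM : ∀ ε > 0, ∃ δ > 0, ∀ u w : E, ‖u‖ < δ → ‖w‖ < δ →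
      |inner ℝ (Φ (a + u) - Φ a) (Φ (a + w) - Φ a) - M u w| ≤ ε * ‖u‖ * ‖w‖) :
    DifferentiableAt ℝ Φ a := by
  set S : E → H := fun u => Φ (a + u) - Φ a with hS
  set t : ℕ → ℝ := fun n => 1 / ((n : ℝ) + 1) with ht
  have ht0 : ∀ n, 0 < t n := fun n => by simp only [ht]; positivity
  have htlim : Tendsto t atTop (𝓝 0) := tendsto_one_div_add_atTop_nhds_zero_nat
  have htv : ∀ (v : E) (δ : ℝ), 0 < δ → ∀ᶠ n in atTop, ‖t n • v‖ < δ := fun v δ hδ => by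
    have h : Tendsto (fun n => ‖t n • v‖) atTop (𝓝 0) := by
      simpa using (htlim.smul_const v).norm
    exact h.eventually_lt_const hδ
  set T : ℕ → E → H := fun n v => (t n)⁻¹ • S (t n • v) with hT
  -- approximation with one difference quotient
  have key1 : ∀ ε > 0, ∃ δ > 0, ∀ (n : ℕ) (v w : E), ‖t n • v‖ < δ → ‖w‖ < δ →
      |inner ℝ (T n v) (S w) - M v w| ≤ ε * ‖v‖ * ‖w‖ := by
    intro ε hε
    obtain ⟨δ, hδ, h⟩ := hM ε hε
    refine ⟨δ, hδ, fun n v w hv hw => ?_⟩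
    have h1 := h (t n • v) w hv hw
    have h2 : inner ℝ (T n v) (S w) - M v w
        = (t n)⁻¹ * (inner ℝ (S (t n • v)) (S w) - M (t n • v) w) := by
      have := (ht0 n).ne'
      simp only [hT, real_inner_smul_left, map_smul, smul_apply, smul_eq_mul]
      field_simp
    rw [h2, abs_mul, abs_of_pos (inv_pos.2 (ht0 n)), inv_mul_le_iff₀ (ht0 n)]
    rw [norm_smul, Real.norm_of_nonneg (ht0 n).le] at h1
    linarith
  -- The two scales vary independently, as the Cauchy property below requires.
  have key2 : ∀ v w : E, Tendsto (fun p : ℕ × ℕ => inner ℝ (T p.1 v) (T p.2 w))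
      (atTop ×ˢ atTop) (𝓝 (M v w)) := by
    intro v w
    rw [Metric.tendsto_nhds]
    intro η hη
    obtain ⟨δ, hδ, h⟩ := key1 (η / (‖v‖ * ‖w‖ + 1)) (by positivity)
    filter_upwards [(htv v δ hδ).prod_mk (htv w δ hδ)] with p hp
    have h1 := h p.1 v (t p.2 • w) hp.1 hp.2
    have h2 : inner ℝ (T p.1 v) (T p.2 w) - M v w
        = (t p.2)⁻¹ * (inner ℝ (T p.1 v) (S (t p.2 • w)) - M v (t p.2 • w)) := by
      have := (ht0 p.2).ne'
      rw [show T p.2 w = (t p.2)⁻¹ • S (t p.2 • w) from rfl, real_inner_smul_right, map_smul,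
        smul_eq_mul]
      field_simp
    rw [Real.dist_eq, h2, abs_mul, abs_of_pos (inv_pos.2 (ht0 _)), inv_mul_lt_iff₀ (ht0 _)]
    rw [norm_smul, Real.norm_of_nonneg (ht0 _).le] at h1
    refine h1.trans_lt ?_
    have h3 : η / (‖v‖ * ‖w‖ + 1) * (‖v‖ * ‖w‖) < η := by
      rw [div_mul_eq_mul_div, div_lt_iff₀ (by positivity)]
      nlinarith
    nlinarith [mul_lt_mul_of_pos_left h3 (ht0 p.2)]
  -- The squared distance of two quotients expands into three inner products, whose limits `M v v -
  -- 2 M v v + M v v` cancel.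
  have hcauchy : ∀ v, CauchySeq fun n => T n v := by
    intro v
    rw [cauchySeq_iff_tendsto_dist_atTop_0, ← prod_atTop_atTop_eq]
    have e1 : Tendsto (fun p : ℕ × ℕ => (p.1, p.1)) (atTop ×ˢ atTop) (atTop ×ˢ atTop) :=
      tendsto_fst.prodMk tendsto_fst
    have e2 : Tendsto (fun p : ℕ × ℕ => (p.2, p.2)) (atTop ×ˢ atTop) (atTop ×ˢ atTop) :=
      tendsto_snd.prodMk tendsto_snd
    have h1 := (key2 v v).comp e1
    have h2 := (key2 v v).comp e2
    have h3 := ((h1.sub ((key2 v v).const_mul 2)).add h2).sqrt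
    have h4 : √(M v v - 2 * M v v + M v v) = 0 := by
      rw [show M v v - 2 * M v v + M v v = 0 by ring, Real.sqrt_zero]
    rw [h4] at h3
    refine h3.congr fun p => ?_
    rw [dist_eq_norm, ← Real.sqrt_sq (norm_nonneg (T p.1 v - T p.2 v)), norm_sub_sq_real,
      ← real_inner_self_eq_norm_sq, ← real_inner_self_eq_norm_sq]
    rfl
  choose D hD using fun v => cauchySeq_tendsto_of_complete (hcauchy v)
  have hDD : ∀ v w, inner ℝ (D v) (D w) = M v w := fun v w =>
    tendsto_nhds_unique (((hD v).comp tendsto_fst).inner ((hD w).comp tendsto_snd)) (key2 v w)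
  have hDS : ∀ ε > 0, ∃ δ > 0, ∀ (v w : E), ‖w‖ < δ →
      |inner ℝ (D v) (S w) - M v w| ≤ ε * ‖v‖ * ‖w‖ := by
    intro ε hε
    obtain ⟨δ, hδ, h⟩ := key1 ε hε
    refine ⟨δ, hδ, fun v w hw => ?_⟩
    refine le_of_tendsto ((((hD v).inner tendsto_const_nhds).sub_const (M v w)).abs) ?_
    filter_upwards [htv v δ hδ] with n hn using h n v w hn hw
  -- The Gram form of `D` is the bilinear `M`, so the linearity defects have norm zero.
  let L : E →ₗ[ℝ] H :=
    { toFun := D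
      map_add' := fun v w => by
        rw [← sub_eq_zero, ← inner_self_eq_zero (𝕜 := ℝ)]
        simp only [inner_sub_left, inner_sub_right, inner_add_left, inner_add_right, hDD, map_add,
          add_apply]
        ring
      map_smul' := fun c v => by
        rw [← sub_eq_zero, ← inner_self_eq_zero (𝕜 := ℝ)]
        simp only [inner_sub_left, inner_sub_right, real_inner_smul_left, real_inner_smul_right,
          hDD, map_smul, smul_apply, smul_eq_mul, RingHom.id_apply]
        ring }
  have hLbound : ∀ v, ‖L v‖ ≤ √‖M‖ * ‖v‖ := by
    intro v
    refine le_of_sq_le_sq ?_ (by positivity)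
    rw [mul_pow, Real.sq_sqrt (norm_nonneg M), ← real_inner_self_eq_norm_sq]
    change inner ℝ (D v) (D v) ≤ _
    rw [hDD]
    refine (le_abs_self _).trans ((M.le_opNorm₂ v v).trans_eq (by ring))
  let D' : E →L[ℝ] H := L.mkContinuous _ hLbound
  refine HasFDerivAt.differentiableAt (f' := D') ?_
  rw [hasFDerivAt_iff_isLittleO_nhds_zero, Asymptotics.isLittleO_iff]
  intro c hc
  -- `‖S w - D w‖²` is `(⟪S w, S w⟫ - M w w) - 2 (⟪D w, S w⟫ - M w w)`: three errors of size `c² / 3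
  -- * ‖w‖²`.
  obtain ⟨δ₁, hδ₁, h₁⟩ := hM (c ^ 2 / 3) (by positivity)
  obtain ⟨δ₂, hδ₂, h₂⟩ := hDS (c ^ 2 / 3) (by positivity)
  filter_upwards [Metric.ball_mem_nhds (0 : E) (lt_min hδ₁ hδ₂)] with w hw
  rw [mem_ball_zero_iff, lt_min_iff] at hw
  change ‖S w - D w‖ ≤ c * ‖w‖
  refine le_of_sq_le_sq ?_ (by positivity)
  have e1 := abs_le.1 (h₁ w w hw.1 hw.1)
  have e2 := abs_le.1 (h₂ w w hw.2)
  have e3 : ‖S w - D w‖ ^ 2 = inner ℝ (S w) (S w) - 2 * inner ℝ (D w) (S w) + M w w := by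
    rw [norm_sub_sq_real, ← real_inner_self_eq_norm_sq, ← real_inner_self_eq_norm_sq, hDD,
      real_inner_comm (D w) (S w)]
  rw [e3]
  change (_ ≤ inner ℝ (S w) (S w) - M w w) ∧ (inner ℝ (S w) (S w) - M w w ≤ _) at e1
  nlinarith [e1.1, e1.2, e2.1, e2.2]

/-- If the Gram kernel `⟪Φ x, Φ y⟫` is of class `C^2` at `(a, a)`, then `Φ` is differentiable
at `a`. -/
theorem differentiableAt_of_contDiffAt_inner {E H : Type*} [NormedAddCommGroup E]
    [NormedSpace ℝ E] [NormedAddCommGroup H] [InnerProductSpace ℝ H] [CompleteSpace H]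
    {Φ : E → H} {a : E}
    (h : ContDiffAt ℝ 2 (fun p : E × E => inner ℝ (Φ p.1) (Φ p.2)) (a, a)) :
    DifferentiableAt ℝ Φ a := by
  set k : E × E → ℝ := fun p => inner ℝ (Φ p.1) (Φ p.2) with hk
  have hk1 : ContDiffAt ℝ 1 (fderiv ℝ k) (a, a) := h.fderiv_right (by norm_num)
  -- Strictness is needed to compare `Dk` at two points that both move near `(a, a)`.
  have hstrict := hk1.hasStrictFDerivAt one_ne_zero
  set F := fderiv ℝ (fderiv ℝ k) (a, a)
  have hdiff : ∀ᶠ p in nhds (a, a), DifferentiableAt ℝ k p :=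
    (h.eventually (by simp)).mono fun p hp => hp.differentiableAt (by simp)
  -- The mixed second derivative: `B w v = D²k (0, w) (v, 0)`.
  let B : E →L[ℝ] E →L[ℝ] ℝ :=
    (ContinuousLinearMap.precomp ℝ (ContinuousLinearMap.inl ℝ E E)).comp
      (F.comp (ContinuousLinearMap.inr ℝ E E))
  refine differentiableAt_of_inner_sub_approx B.flip fun ε hε => ?_
  have hs := (Asymptotics.isLittleO_iff.1 hstrict.isLittleO) hε
  obtain ⟨δ₁, hδ₁, hb⟩ := Metric.eventually_nhds_iff.1 hs
  obtain ⟨δ₂, hδ₂, hd⟩ := Metric.eventually_nhds_iff.1 hdiff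
  refine ⟨min δ₁ δ₂, lt_min hδ₁ hδ₂, fun u w hu hw => ?_⟩
  have hd1 : ∀ x y : E, ‖x‖ < min δ₁ δ₂ → ‖y‖ < min δ₁ δ₂ →
      HasFDerivAt (fun x => k (a + x, a + y))
        ((fderiv ℝ k (a + x, a + y)).comp (ContinuousLinearMap.inl ℝ E E)) x := by
    intro x y hx hy
    have hkd : DifferentiableAt ℝ k (a + x, a + y) := by
      apply hd
      simpa [Prod.dist_eq] using
        ⟨hx.trans_le (min_le_right _ _), hy.trans_le (min_le_right _ _)⟩
    have hi : HasFDerivAt (fun x : E => (a + x, a + y)) (ContinuousLinearMap.inl ℝ E E) x :=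
      ((hasFDerivAt_id x).const_add a).prodMk (hasFDerivAt_const (a + y) x)
    exact hkd.hasFDerivAt.comp x hi
  have h0 : ‖(0 : E)‖ < min δ₁ δ₂ := by simpa using ⟨hδ₁, hδ₂⟩
  -- The inner product of two increments is a second difference of `k`, that is, an increment in `x`
  -- of the function below; the mean value inequality bounds its deviation from `B w u`.
  have hmv := (convex_ball (0 : E) (min δ₁ δ₂)).norm_image_sub_le_of_norm_hasFDerivWithin_le'
    (f := fun x => k (a + x, a + w) - k (a + x, a + 0)) (φ := B w) (C := ε * ‖w‖)
    (fun x hx => ((hd1 x w (mem_ball_zero_iff.1 hx) hw).sub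
      (hd1 x 0 (mem_ball_zero_iff.1 hx) h0)).hasFDerivWithinAt) ?_
    (x := 0) (y := u) (mem_ball_zero_iff.2 h0) (mem_ball_zero_iff.2 hu)
  · simp only [hk, add_zero, sub_zero, Real.norm_eq_abs] at hmv
    calc _ = _ := ?_
      _ ≤ _ := hmv
      _ = _ := by ring
    congr 1
    simp only [inner_sub_left, inner_sub_right, ContinuousLinearMap.flip_apply]
    ring
  · intro x hx
    have hx := mem_ball_zero_iff.1 hx
    have hb1 := @hb ((a + x, a + w), (a + x, a + 0)) (by
      simpa [Prod.dist_eq, hδ₁] using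
        ⟨hx.trans_le (min_le_left _ _), hw.trans_le (min_le_left _ _)⟩)
    have e : (a + x, a + w) - (a + x, a + 0) = ((0, w) : E × E) := by simp
    simp only [e] at hb1
    have e2 : (fderiv ℝ k (a + x, a + w)).comp (ContinuousLinearMap.inl ℝ E E)
        - (fderiv ℝ k (a + x, a + 0)).comp (ContinuousLinearMap.inl ℝ E E) - B w
        = (fderiv ℝ k (a + x, a + w) - fderiv ℝ k (a + x, a + 0) - F (0, w)).comp
          (ContinuousLinearMap.inl ℝ E E) := by
      ext v; simp [B]
    rw [e2]
    refine (ContinuousLinearMap.opNorm_comp_le _ _).trans ?_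
    refine (mul_le_of_le_one_right (norm_nonneg _)
      (ContinuousLinearMap.norm_inl_le_one ℝ E E)).trans ?_
    simpa [Prod.norm_def] using hb1

open Manifold in
/-- A map from a boundaryless manifold to a Hilbert space whose Gram kernel is of class `C^2` is
differentiable. -/
theorem mdifferentiable_of_contMDiff_inner {E X M H : Type*} [NormedAddCommGroup E]
    [NormedSpace ℝ E] [TopologicalSpace X] {I : ModelWithCorners ℝ E X} [I.Boundaryless]
    [TopologicalSpace M] [ChartedSpace X M] [IsManifold I ∞ M]
    [NormedAddCommGroup H] [InnerProductSpace ℝ H] [CompleteSpace H] {Φ : M → H}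
    (h : ContMDiff (I.prod I) 𝓘(ℝ, ℝ) 2 (fun p : M × M => inner ℝ (Φ p.1) (Φ p.2))) :
    MDifferentiable I 𝓘(ℝ, H) Φ := by
  intro x
  set e := extChartAt I x
  have hsymm : ContMDiffAt 𝓘(ℝ, E) I 2 e.symm (e x) :=
    (contMDiffOn_extChartAt_symm x).contMDiffAt (extChartAt_target_mem_nhds x)
  have hd : DifferentiableAt ℝ (Φ ∘ e.symm) (e x) := by
    refine differentiableAt_of_contDiffAt_inner ?_
    rw [← contMDiffAt_iff_contDiffAt]
    have h1 : ContMDiffAt 𝓘(ℝ, E × E) I 2 (fun p : E × E => e.symm p.1) (e x, e x) :=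
      ContMDiffAt.comp (e x, e x) hsymm contDiff_fst.contMDiff.contMDiffAt
    have h2 : ContMDiffAt 𝓘(ℝ, E × E) I 2 (fun p : E × E => e.symm p.2) (e x, e x) :=
      ContMDiffAt.comp (e x, e x) hsymm contDiff_snd.contMDiff.contMDiffAt
    exact ContMDiffAt.comp (e x, e x) h.contMDiffAt (h1.prodMk h2)
  refine (hd.mdifferentiableAt.comp x
    (mdifferentiableAt_extChartAt (mem_chart_source X x))).congr_of_eventuallyEq ?_
  filter_upwards [extChartAt_source_mem_nhds (I := I) x] with y hy
  simp [e.left_inv hy]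

/-! ### Reproducing property of differentials and skew-symmetry -/

section Poisson

variable {d : ℕ} {P : Type*} [TopologicalSpace P] [ChartedSpace (EuclideanSpace ℝ (Fin d)) P]

/-- Differential reproducing property: if evaluation at every point is the inner product with the
feature map `Φ`, then the differential of `h` is the inner product with the differential of
`Φ`. -/
theorem hasMFDerivAt_of_apply_eq_inner {H : Type*} [NormedAddCommGroup H]
    [InnerProductSpace ℝ H] {Φ : P → H} {z : P} (hΦ : MDifferentiableAt (𝓡 d) 𝓘(ℝ, H) Φ z)
    {h : H} {f : P → ℝ} (hf : ∀ y, f y = inner ℝ h (Φ y)) :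
    HasMFDerivAt (𝓡 d) 𝓘(ℝ, ℝ) f z ((innerSL ℝ h).comp (mfderiv (𝓡 d) 𝓘(ℝ, H) Φ z)) := by
  rw [show f = innerSL ℝ h ∘ Φ from funext hf]
  exact (innerSL ℝ h).hasMFDerivAt.comp z hΦ.hasMFDerivAt

theorem mvfderiv_apply_eq_inner {H : Type*} [NormedAddCommGroup H]
    [InnerProductSpace ℝ H] {Φ : P → H} {z : P} (hΦ : MDifferentiableAt (𝓡 d) 𝓘(ℝ, H) Φ z)
    {h : H} {f : P → ℝ} (hf : ∀ y, f y = inner ℝ h (Φ y)) (v : TangentSpace (𝓡 d) z) :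
    mvfderiv (𝓡 d) f z v = inner ℝ h (mvfderiv (𝓡 d) Φ z v) := by
  simp only [mvfderiv, (hasMFDerivAt_of_apply_eq_inner hΦ hf).mfderiv]
  rfl

theorem PoissonBracket.bracket_swap (pb : PoissonBracket d P) (F G : C^∞⟮𝓡 d, P; ℝ⟯) :
    pb.bracket F G = -pb.bracket G F := by
  have h := pb.alternating (F + G)
  simp only [map_add, LinearMap.add_apply, pb.alternating, zero_add, add_zero] at h
  exact eq_neg_of_add_eq_zero_right h

variable [T2Space P] [IsManifold (𝓡 d) ∞ P]

theorem PoissonBracket.tensor_swap (pb : PoissonBracket d P) (z : P)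
    (α β : Module.Dual ℝ (TangentSpace (𝓡 d) z)) : pb.tensor z α β = -pb.tensor z β α := by
  unfold PoissonBracket.tensor
  rw [pb.bracket_swap]
  rfl

/-- `B^♯` as a linear map. -/
def PoissonBracket.sharpₗ (pb : PoissonBracket d P) (z : P) :
    Module.Dual ℝ (TangentSpace (𝓡 d) z) →ₗ[ℝ] TangentSpace (𝓡 d) z where
  toFun := pb.sharp z
  map_add' β β' := by
    unfold PoissonBracket.sharp
    rw [← map_add]
    congr 1
    ext α
    simp [PoissonBracket.tensor]
  map_smul' c β := by
    unfold PoissonBracket.sharp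
    rw [RingHom.id_apply, ← map_smul]
    congr 1
    ext α
    simp [PoissonBracket.tensor]

/-- Skew-symmetry of `J` with respect to `g`, tested on a differential. -/
theorem PoissonBracket.inner_hamVF (pb : PoissonBracket d P) (g : RiemMetric (𝓡 d) P)
    (h : P → ℝ) (z : P) (v : TangentSpace (𝓡 d) z) :
    g.inner z v (pb.hamVF h z) = -mvfderiv (𝓡 d) h z (pb.compat g z v) := by
  have h1 := pb.apply_sharp z (g.inner z v : TangentSpace (𝓡 d) z →ₗ[ℝ] ℝ)
    (mvfderiv (𝓡 d) h z : TangentSpace (𝓡 d) z →ₗ[ℝ] ℝ)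
  have h2 := pb.apply_sharp z (mvfderiv (𝓡 d) h z : TangentSpace (𝓡 d) z →ₗ[ℝ] ℝ)
    (g.inner z v : TangentSpace (𝓡 d) z →ₗ[ℝ] ℝ)
  -- `g(v, X_h) = B(g♭ v, dh) = -B(dh, g♭ v) = -dh(J v)`.
  rw [pb.tensor_swap, ← h2] at h1
  exact h1

end Poisson

/-! ### Abstract ridge regression -/

section TikhonovRegularization

/-- Tikhonov regularization: for `L : H → V` with adjoint `Ls` with respect to a positive definite
bilinear form `B` on the finite-dimensional space `V`, the operator `L ∘ Ls + μ` is invertible. -/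
theorem injective_comp_adjoint_add_smul {H V : Type*} [NormedAddCommGroup H]
    [InnerProductSpace ℝ H] [AddCommGroup V] [Module ℝ V] (B : LinearMap.BilinForm ℝ V)
    (hpos : ∀ v, v ≠ 0 → 0 < B v v) (L : H →ₗ[ℝ] V) (Ls : V →ₗ[ℝ] H)
    (hadj : ∀ c h, B c (L h) = inner ℝ (Ls c) h) {μ : ℝ} (hμ : 0 < μ) :
    Function.Injective (L ∘ₗ Ls + μ • LinearMap.id : V →ₗ[ℝ] V) := by
  rw [injective_iff_map_eq_zero]
  intro c hc
  by_contra hne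
  have h1 : B c ((L ∘ₗ Ls + μ • LinearMap.id : V →ₗ[ℝ] V) c) = ‖Ls c‖ ^ 2 + μ * B c c := by
    simp [hadj]
  rw [hc, map_zero] at h1
  have := mul_pos hμ (hpos c hne)
  nlinarith [sq_nonneg ‖Ls c‖]

/-- Completing the square in the regularized least squares functional at `Ls c`, where `c` solves
`L (Ls c) + (lam * m) • c = x`. -/
theorem regularizedRisk_eq {H V : Type*} [NormedAddCommGroup H]
    [InnerProductSpace ℝ H] [AddCommGroup V] [Module ℝ V] (B : LinearMap.BilinForm ℝ V)
    (hsymm : ∀ v w, B v w = B w v) (L : H →ₗ[ℝ] V) (Ls : V →ₗ[ℝ] H)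
    (hadj : ∀ c h, B c (L h) = inner ℝ (Ls c) h) {lam m : ℝ} (hm : m ≠ 0) {c x : V}
    (hc : L (Ls c) + (lam * m) • c = x) (h : H) :
    1 / m * B (L h - x) (L h - x) + lam * ‖h‖ ^ 2
      = (1 / m * B (L (Ls c) - x) (L (Ls c) - x) + lam * ‖Ls c‖ ^ 2)
        + (1 / m * B (L (h - Ls c)) (L (h - Ls c)) + lam * ‖h - Ls c‖ ^ 2) := by
  obtain ⟨u, rfl⟩ : ∃ u, h = Ls c + u := ⟨h - Ls c, by abel⟩
  -- The residual is a multiple of `c`, so by adjointness its cross term with `L u` is `-2 lam ⟪Ls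
  -- c, u⟫`, cancelling that of the norm.
  have e1 : L (Ls c) - x = -((lam * m) • c) := by rw [← hc]; abel
  have e2 : L (Ls c + u) - x = L u - (lam * m) • c := by rw [← hc, map_add]; abel
  rw [e1, e2, add_sub_cancel_left, norm_add_sq_real]
  simp only [map_sub, map_neg, map_smul, LinearMap.sub_apply, LinearMap.neg_apply,
    LinearMap.smul_apply, smul_eq_mul, hsymm (L u) c, hadj]
  field_simp
  ring

end TikhonovRegularization

/-! ### The sampling operator, its adjoint and the Gram map -/

section Poisson

variable {d : ℕ} {P : Type*} [TopologicalSpace P] [ChartedSpace (EuclideanSpace ℝ (Fin d)) P]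
  [IsManifold (𝓡 d) ∞ P]

/-- The inner product `g_N` as a bilinear form. -/
def innerNForm (g : RiemMetric (𝓡 d) P) {N : ℕ} (z : Fin N → P) :
    LinearMap.BilinForm ℝ (TangentProd d z) :=
  LinearMap.mk₂ ℝ (innerN g z)
    (fun u u' v => by simp [innerN, Finset.sum_add_distrib])
    (fun c u v => by simp [innerN, Finset.mul_sum])
    (fun u v v' => by simp [innerN, Finset.sum_add_distrib])
    (fun c u v => by simp [innerN, Finset.mul_sum])

theorem innerNForm_apply (g : RiemMetric (𝓡 d) P) {N : ℕ} (z : Fin N → P)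
    (u v : TangentProd d z) : innerNForm g z u v = ∑ n, g.inner (z n) (u n) (v n) := rfl

theorem inner_self_nonneg_riemMetric (g : RiemMetric (𝓡 d) P) (z : P)
    (v : TangentSpace (𝓡 d) z) : 0 ≤ g.inner z v v := by
  rcases eq_or_ne v 0 with rfl | hv
  · simp
  · exact (g.pos z v hv).le

theorem innerNForm_self_nonneg (g : RiemMetric (𝓡 d) P) {N : ℕ} (z : Fin N → P)
    (u : TangentProd d z) : 0 ≤ innerNForm g z u u := by
  rw [innerNForm_apply]
  exact Finset.sum_nonneg fun n _ => inner_self_nonneg_riemMetric g (z n) (u n)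

theorem innerNForm_self_pos (g : RiemMetric (𝓡 d) P) {N : ℕ} (z : Fin N → P)
    (u : TangentProd d z) (hu : u ≠ 0) : 0 < innerNForm g z u u := by
  obtain ⟨n, hn⟩ := Function.ne_iff.1 hu
  rw [innerNForm_apply]
  exact Finset.sum_pos' (fun n _ => inner_self_nonneg_riemMetric g (z n) (u n))
    ⟨n, Finset.mem_univ n, g.pos (z n) (u n) hn⟩

theorem innerNForm_symm (g : RiemMetric (𝓡 d) P) {N : ℕ} (z : Fin N → P)
    (u v : TangentProd d z) : innerNForm g z u v = innerNForm g z v u := by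
  simp only [innerNForm_apply]
  exact Finset.sum_congr rfl fun n _ => g.symm (z n) (u n) (v n)

variable [T2Space P] {ℋ : Type*} [NormedAddCommGroup ℋ] [InnerProductSpace ℝ ℋ]

/-- The sampling operator `h ↦ X_h(z_N)` on a Hilbert space with feature map `Φ`, through
`dh(z) v = ⟪h, dΦ(z) v⟫`. -/
def samplingMap (pb : PoissonBracket d P) (Φ : P → ℋ) {N : ℕ} (z : Fin N → P) :
    ℋ →ₗ[ℝ] TangentProd d z :=
  LinearMap.pi fun n => pb.sharpₗ (z n) ∘ₗ
    ((innerₗ ℋ).compl₂ (mvfderiv (𝓡 d) Φ (z n) : TangentSpace (𝓡 d) (z n) →ₗ[ℝ] ℋ))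

theorem samplingMap_apply (pb : PoissonBracket d P) {Φ : P → ℋ}
    (hΦ : MDifferentiable (𝓡 d) 𝓘(ℝ, ℋ) Φ) {N : ℕ} (z : Fin N → P) {h : ℋ} {f : P → ℝ}
    (hf : ∀ y, f y = inner ℝ h (Φ y)) (n : Fin N) :
    samplingMap pb Φ z h n = pb.hamVF f (z n) := by
  change pb.sharp (z n) _ = pb.sharp (z n) _
  congr 1
  ext v
  exact (mvfderiv_apply_eq_inner (hΦ (z n)) hf v).symm

/-- The compatible structure `J(z)` as a linear map. -/
def PoissonBracket.compatₗ (pb : PoissonBracket d P) (g : RiemMetric (𝓡 d) P) (z : P) :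
    TangentSpace (𝓡 d) z →ₗ[ℝ] TangentSpace (𝓡 d) z where
  toFun := pb.compat g z
  map_add' u v := by
    refine Eq.trans ?_ ((pb.sharpₗ z).map_add _ _)
    exact congrArg (pb.sharp z) (LinearMap.ext fun w => by simp)
  map_smul' c v := by
    refine Eq.trans ?_ ((pb.sharpₗ z).map_smul _ _)
    exact congrArg (pb.sharp z) (LinearMap.ext fun w => by simp)

/-- The adjoint of the sampling operator. -/
def samplingAdjoint (pb : PoissonBracket d P) (g : RiemMetric (𝓡 d) P) (Φ : P → ℋ) {N : ℕ}
    (z : Fin N → P) : TangentProd d z →ₗ[ℝ] ℋ :=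
  -∑ n, (mvfderiv (𝓡 d) Φ (z n) : TangentSpace (𝓡 d) (z n) →ₗ[ℝ] ℋ) ∘ₗ
    pb.compatₗ g (z n) ∘ₗ LinearMap.proj n

theorem innerNForm_samplingMap (pb : PoissonBracket d P) (g : RiemMetric (𝓡 d) P) {Φ : P → ℋ}
    (hΦ : MDifferentiable (𝓡 d) 𝓘(ℝ, ℋ) Φ) {N : ℕ} (z : Fin N → P) (c : TangentProd d z)
    (h : ℋ) :
    innerNForm g z c (samplingMap pb Φ z h) = inner ℝ (samplingAdjoint pb g Φ z c) h := by
  have h1 : ∀ y, (fun y => inner ℝ h (Φ y)) y = inner ℝ h (Φ y) := fun y => rfl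
  rw [innerNForm_apply, real_inner_comm]
  simp only [samplingAdjoint, LinearMap.neg_apply, LinearMap.sum_apply, inner_neg_right, inner_sum,
    ← Finset.sum_neg_distrib]
  refine Finset.sum_congr rfl fun n _ => ?_
  rw [samplingMap_apply pb hΦ z h1, pb.inner_hamVF, mvfderiv_apply_eq_inner (hΦ (z n)) h1]
  rfl

/-- As `K y` is represented by `Φ y`, the expansion pairs `c` with the samples of `Φ y`; moving the
sampling operator across shows that the adjoint at `c` represents the expansion in `ℋ`. -/
theorem kernelExpansion_eq_inner (pb : PoissonBracket d P) (g : RiemMetric (𝓡 d) P) {Φ : P → ℋ}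
    (hΦ : MDifferentiable (𝓡 d) 𝓘(ℝ, ℋ) Φ) {K : P → P → ℝ}
    (hK : ∀ x y, K x y = inner ℝ (Φ x) (Φ y)) {N : ℕ} (z : Fin N → P) (c : TangentProd d z)
    (y : P) : kernelExpansion pb g K z c y = inner ℝ (samplingAdjoint pb g Φ z c) (Φ y) := by
  rw [← innerNForm_samplingMap pb g hΦ, innerNForm_apply]
  unfold kernelExpansion innerN
  simp only [samplingMap_apply pb hΦ z (hK y)]

/-- The factorization `G_N = L L*`, which makes `G_N` linear and positive semidefinite for `g_N`. -/
theorem gramMap_eq_samplingMap (pb : PoissonBracket d P) (g : RiemMetric (𝓡 d) P) {Φ : P → ℋ}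
    (hΦ : MDifferentiable (𝓡 d) 𝓘(ℝ, ℋ) Φ) {K : P → P → ℝ}
    (hK : ∀ x y, K x y = inner ℝ (Φ x) (Φ y)) {N : ℕ} (z : Fin N → P) (c : TangentProd d z) :
    gramMap pb g K z c = samplingMap pb Φ z (samplingAdjoint pb g Φ z c) :=
  funext fun n =>
    (samplingMap_apply pb hΦ z (kernelExpansion_eq_inner pb g hΦ hK z c) n).symm

end Poisson

end

/-! ### The representer theorem -/

theorem theorem3p7 {d : ℕ} {P : Type*} [TopologicalSpace P] [T2Space P]
    [SecondCountableTopology P] [ChartedSpace (EuclideanSpace ℝ (Fin d)) P]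
    [IsManifold (𝓡 d) ∞ P] (pb : PoissonBracket d P) (g : RiemMetric (𝓡 d) P)
    (hJ : pb.IsBoundedCompat g)
    (g₀ : RiemMetric ((𝓡 d).prod (𝓡 d)) (P × P))
    (g₁ : RiemMetric ((𝓡 d).prod (𝓡 d)).tangent (TangentBundle ((𝓡 d).prod (𝓡 d)) (P × P)))
    (g₂ : RiemMetric ((𝓡 d).prod (𝓡 d)).tangent.tangent
      (TangentBundle ((𝓡 d).prod (𝓡 d)).tangent (TangentBundle ((𝓡 d).prod (𝓡 d)) (P × P))))
    (K : P → P → ℝ) (hK : IsMercerKernel K)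
    (hK₃ : MemCb3 g₀ g₁ g₂ (fun p : P × P => K p.1 p.2))
    (ℋ : Type*) [NormedAddCommGroup ℋ] [InnerProductSpace ℝ ℋ] [CompleteSpace ℋ]
    [RKHS ℝ ℋ P ℝ] (hℋ : IsRKHSOf ℋ K)
    {N : ℕ} (hN : 0 < N) (z : Fin N → P) (x : TangentProd d z) (lam : ℝ) (hlam : 0 < lam) :
    -- every function in `ℋ` is differentiable
    (∀ h : ℋ, MDifferentiable (𝓡 d) 𝓘(ℝ, ℝ) h) ∧
    -- `A` is the operator `G_N + λ N I`, which is linear and invertible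
    ∃ A : TangentProd d z ≃ₗ[ℝ] TangentProd d z,
      (∀ c, A c = gramMap pb g K z c + (lam * N) • c) ∧
      ∃ h : ℋ, (∀ y, h y = kernelExpansion pb g K z (A.symm x) y) ∧
        ∀ h' : ℋ, IsMinOn (empRisk pb g ℋ z x lam) Set.univ h' ↔ h' = h := by
  choose Φ hΦK hΦ using hℋ
  have hKΦ : ∀ x y, K x y = inner ℝ (Φ x) (Φ y) := fun x y => by rw [← hΦK, hΦ]
  have hdiff : MDifferentiable (𝓡 d) 𝓘(ℝ, ℋ) Φ := by
    refine mdifferentiable_of_contMDiff_inner ?_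
    simp only [← hKΦ]
    exact hK₃.contMDiff.of_le (by norm_num)
  refine ⟨fun h y =>
    (hasMFDerivAt_of_apply_eq_inner (hdiff y) (fun y => hΦ y h)).mdifferentiableAt, ?_⟩
  have hN' : (0 : ℝ) < N := Nat.cast_pos.2 hN
  have hadj := innerNForm_samplingMap pb g hdiff z
  -- In finite dimension, injectivity suffices for invertibility.
  let A := LinearEquiv.ofInjectiveEndo _ (injective_comp_adjoint_add_smul (innerNForm g z)
    (innerNForm_self_pos g z) _ _ hadj (mul_pos hlam hN'))
  have hA : ∀ c, A c = gramMap pb g K z c + (lam * N) • c := fun c => by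
    rw [gramMap_eq_samplingMap pb g hdiff hKΦ]
    rfl
  refine ⟨A, hA, samplingAdjoint pb g Φ z (A.symm x), fun y => ?_, fun h' => ?_⟩
  · rw [hΦ, kernelExpansion_eq_inner pb g hdiff hKΦ]
  set h₀ := samplingAdjoint pb g Φ z (A.symm x) with hh₀
  -- The excess risk over `h₀` is at least `lam * ‖h - h₀‖²`, so `h₀` is a minimizer and the only
  -- one.
  have hrisk : ∀ h : ℋ, empRisk pb g ℋ z x lam h = empRisk pb g ℋ z x lam h₀
      + (1 / N * innerNForm g z (samplingMap pb Φ z (h - h₀)) (samplingMap pb Φ z (h - h₀))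
        + lam * ‖h - h₀‖ ^ 2) := by
    have hc : samplingMap pb Φ z h₀ + (lam * N) • A.symm x = x := A.apply_symm_apply x
    have hemp : ∀ h : ℋ, empRisk pb g ℋ z x lam h
        = 1 / N * innerNForm g z (samplingMap pb Φ z h - x) (samplingMap pb Φ z h - x)
          + lam * ‖h‖ ^ 2 := fun h => by
      simp only [empRisk, innerNForm_apply, Pi.sub_apply,
        samplingMap_apply pb hdiff z (fun y => hΦ y h)]
    intro h
    rw [hemp h, hemp h₀]
    exact regularizedRisk_eq (innerNForm g z) (innerNForm_symm g z) _ _ hadj hN'.ne' hc h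
  have hnn : ∀ h : ℋ, 0 ≤ 1 / N * innerNForm g z (samplingMap pb Φ z (h - h₀))
      (samplingMap pb Φ z (h - h₀)) := fun h =>
    mul_nonneg (by positivity) (innerNForm_self_nonneg g z _)
  rw [isMinOn_univ_iff]
  constructor
  · intro hmin
    have h1 := hmin h₀
    rw [hrisk h'] at h1
    have h2 : lam * ‖h' - h₀‖ ^ 2 ≤ 0 := by linarith [hnn h']
    have h3 : ‖h' - h₀‖ ^ 2 = 0 := le_antisymm (nonpos_of_mul_nonpos_right h2 hlam) (sq_nonneg _)
    exact sub_eq_zero.1 (norm_eq_zero.1 (pow_eq_zero_iff two_ne_zero |>.1 h3))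
  · rintro rfl h
    rw [hrisk h]
    have := mul_nonneg hlam.le (sq_nonneg ‖h - h₀‖)
    linarith [hnn h]
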